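/- \textbf{Setting.} There are $K\ge 2$ arms with a joint reward vector $(R_1,\dots,R_K)\in[0,1]^K$ and means $\mu_k=\mathbb E[R_k]$; the best arm $k^*$ is unique, i.e. $\mu_k<\mu_{k^*}$ for $k\ne k^*$. Put $\mu_{(2)}=\max_{k\ne k^*}\mu_k$, $\Delta_k=\mu_{k^*}-\mu_k$ for $k\neq k^*$ and $\Delta_{k^*}=\min_{k\ne k^*}\Delta_k$. Known measurable pseudo-rewards $s_{\ell,k}\le 1$ are given with $\mathbb E[R_\ell\mid R_k]\le s_{\ell,k}(R_k)$ almost surely and $s_{k,k}(r)=r$; let $\phi_{\ell,k}=\mathbb E[s_{\ell,k}(R_k)]$. The set of competitive arms is $\mathcal C=\{\ell:\mu_{(2)}-\phi_{\ell,k^*}\le 0\}$; assume $\Delta_k<1$ for $k\in\mathcal C$, so that $\log\log(1/\Delta_k^2)$ is defined. The successive samples of each arm $k$ are i.i.d. with the law of $R_k$ (nothing is assumed about the dependence between the samples of different arms). Let $B(n,\delta)$ be an anytime confidence bound: for every i.i.d. sequence in $[0,1]$ with mean $\mu$ and empirical means $\hat\mu_n$, $\Pr(\exists n\ge1:\ |\hat\mu_n-\mu|>B(n,\delta))\le\delta$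 for all $\delta\in(0,1)$; and there is a constant $c$ with $B(n,\delta)\le c\sqrt{\log(\log n/\delta)/n}$ for all $n\ge3$, $\delta\in(0,1)$. \textbf{C-LUCB with confidence parameter $\delta$.} Sample every arm once and let all arms be active. At the start of round $t=1,2,\dots$ let $n_k$ be the number of samples of arm $k$ so far, $\hat\mu_k$ and $\hat\phi_{\ell,k}$ the averages of the rewards $r$, respectively of $s_{\ell,k}(r)$, over these samples, and $$I_\ell=\min_k\Big(\hat\phi_{\ell,k}+\sqrt{\tfrac{2\log t}{n_k}}\Big),\quad \tilde U_{\ell,k}=\hat\phi_{\ell,k}+B\big(n_k,\tfrac{\delta}{2K}\big),\quad \tilde U_\ell=\min_k\tilde U_{\ell,k},\quad L_k=\hat\mu_k-B\big(n_k,\tfrac{\delta}{2K}\big).$$ In round $t$ the algorithm samples $m_1(t)$, an active arm maximising $I_k$, and $m_2(t)$, an active arm other than $m_1(t)$ maximising $\min(\tilde U_{k,k},I_k)$ (ties are broken arbitrarily); then, with the updated samples, it removes every active arm $k$ with $\tilde U_k<\max_{\ell\text{ active}}L_\ell$. It stops when exactly one arm is active. Let $N_\delta$ be the total number of samples drawn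 until stopping ($N_\delta=\infty$ if it never stops), let $T^{(NC)}_\delta$ be the number of rounds played in which a non-competitive arm is sampled and the other sampled arm is not $k^*$, and let $T^{(\mathcal R)}_\delta$ be the number of rounds played in which $I_{k^*}<\mu_{k^*}$. \textbf{Statement.} There is a constant $\zeta>0$, depending only on $B$, such that for every instance as above there are random variables $d_1,d_2$ with finite expectation (in particular, almost surely finite), depending neither on $\delta$ nor on the tie-breaking, such that for every $\delta\in(0,1)$, with probability at least $1-\delta$, C-LUCB stops, $T^{(NC)}_\delta\le d_1$, $T^{(\mathcal R)}_\delta\le d_2$, and $$N_\delta\;\le\;\sum_{k\in\mathcal C}\frac{2\zeta}{\Delta_k^2}\log\!\left(\frac{2K\log(1/\Delta_k^2)}{\delta}\right)+d,\qquad d=\max(d_1,d_2).$$ (The algorithms for different $\delta$ are run on the same table of rewards: the $i$-th sample of arm $k$ does not depend on $\delta$.) -/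

import Mathlib

open MeasureTheory ProbabilityTheory

noncomputable section

namespace CLUCB

/-- `B n δ` is an anytime confidence bound for `[0,1]`-valued rewards, of iterated-logarithm width.
`coverage`: for every i.i.d. sequence of rewards in `[0,1]` with law `ρ`, with probability at least
`1 - δ` the mean lies in `[empirical mean - B n δ, empirical mean + B n δ]` for all `n ≥ 1` at once.
`rate`: `B n δ` is at most a constant multiple of `√(log (log n / δ) / n)`; it is required from
`n = 3` on, where `log (log n / δ)` is defined and positive for every `δ < 1`. -/
structure IsAnytimeBound (B : ℕ → ℝ → ℝ) : Prop where
  coverage : ∀ ρ : Measure ℝ, IsProbabilityMeasure ρ → (∀ᵐ r ∂ρ, r ∈ Set.Icc (0 : ℝ) 1) →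
    ∀ δ : ℝ, 0 < δ → δ < 1 →
      Measure.infinitePi (fun _ : ℕ => ρ)
        {x | ∃ n : ℕ, 1 ≤ n ∧ B n δ < |(∑ i ∈ Finset.range n, x i) / n - ∫ r, r ∂ρ|}
        ≤ ENNReal.ofReal δ
  rate : ∃ c : ℝ, ∀ n : ℕ, 3 ≤ n → ∀ δ : ℝ, 0 < δ → δ < 1 →
    B n δ ≤ c * √(Real.log (Real.log n / δ) / n)

section Model

variable {K : ℕ}

/-- Mean reward `μ_k` of arm `k`, where `ν` is the joint law of the rewards `(R_1, …, R_K)`. -/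
def mean (ν : Measure (Fin K → ℝ)) (k : Fin K) : ℝ := ∫ r, r k ∂ν

/-- `s ℓ k r` is a pseudo-reward of arm `ℓ` with respect to arm `k`: an upper bound on
`E[R_ℓ | R_k = r]`. Rewards lie in `[0,1]`, and pseudo-rewards do not exceed the largest possible
reward `1`. -/
structure IsPseudoReward (ν : Measure (Fin K → ℝ)) (s : Fin K → Fin K → ℝ → ℝ) : Prop where
  measurable : ∀ ℓ k, Measurable (s ℓ k)
  le_one : ∀ ℓ k, ∀ r ∈ Set.Icc (0 : ℝ) 1, s ℓ k r ≤ 1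
  self : ∀ k r, s k k r = r
  condExp_le : ∀ ℓ k,
    ν[fun r => r ℓ | MeasurableSpace.comap (fun r : Fin K → ℝ => r k) inferInstance]
      ≤ᵐ[ν] fun r => s ℓ k (r k)

/-- Expected pseudo-reward `φ_{ℓ,k} = E[s_{ℓ,k}(R_k)]`. -/
def expPseudo (ν : Measure (Fin K → ℝ)) (s : Fin K → Fin K → ℝ → ℝ) (ℓ k : Fin K) : ℝ :=
  ∫ r, s ℓ k (r k) ∂ν

/-- Largest mean among the arms other than `kstar`, i.e. the mean of the second best arm when
`kstar` is the best arm. -/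
def secondMean (ν : Measure (Fin K → ℝ)) (kstar : Fin K) : ℝ :=
  ⨆ k : {k : Fin K // k ≠ kstar}, mean ν k

/-- The gap `Δ_k = μ_{k*} - μ_k` for `k ≠ k*`, and `Δ_{k*} = min_{k ≠ k*} Δ_k`. -/
def gap (ν : Measure (Fin K → ℝ)) (kstar k : Fin K) : ℝ :=
  if k = kstar then ⨅ j : {j : Fin K // j ≠ kstar}, (mean ν kstar - mean ν j)
  else mean ν kstar - mean ν k

open Classical in
/-- The set `𝒞` of competitive arms: those whose pseudo-gap `μ_{k⁽²⁾} - φ_{ℓ,k*}` is `≤ 0`. -/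
def competitive (ν : Measure (Fin K → ℝ)) (s : Fin K → Fin K → ℝ → ℝ) (kstar : Fin K) :
    Finset (Fin K) :=
  Finset.univ.filter fun ℓ => secondMean ν kstar - expPseudo ν s ℓ kstar ≤ 0

end Model

section Algorithm

/- In this section `z k i` is the reward observed when arm `k` is sampled for the `(i+1)`-st time,
`n k` is the number of samples of arm `k` seen so far, and `t` is the current round. -/

variable {K : ℕ}

/-- Empirical mean of arm `k`. -/
def empMean (z : Fin K → ℕ → ℝ) (n : Fin K → ℕ) (k : Fin K) : ℝ :=
  (∑ i ∈ Finset.range (n k), z k i) / n k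

/-- Empirical pseudo-reward of arm `ℓ` with respect to arm `k`. -/
def empPseudo (s : Fin K → Fin K → ℝ → ℝ) (z : Fin K → ℕ → ℝ) (n : Fin K → ℕ) (ℓ k : Fin K) : ℝ :=
  (∑ i ∈ Finset.range (n k), s ℓ k (z k i)) / n k

/-- CrossUCB index of arm `ℓ` with respect to arm `k`, at confidence parameter `ε`. -/
def crossUCB₂ (B : ℕ → ℝ → ℝ) (s : Fin K → Fin K → ℝ → ℝ) (z : Fin K → ℕ → ℝ) (n : Fin K → ℕ)
    (ε : ℝ) (ℓ k : Fin K) : ℝ :=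
  empPseudo s z n ℓ k + B (n k) ε

/-- CrossUCB index of arm `ℓ`: the minimum over `k` of its indices with respect to `k`. -/
def crossUCB (B : ℕ → ℝ → ℝ) (s : Fin K → Fin K → ℝ → ℝ) (z : Fin K → ℕ → ℝ) (n : Fin K → ℕ)
    (ε : ℝ) (ℓ : Fin K) : ℝ :=
  ⨅ k : Fin K, crossUCB₂ B s z n ε ℓ k

/-- Lower confidence index of arm `k`, at confidence parameter `ε`. -/
def lcb (B : ℕ → ℝ → ℝ) (z : Fin K → ℕ → ℝ) (n : Fin K → ℕ) (ε : ℝ) (k : Fin K) : ℝ :=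
  empMean z n k - B (n k) ε

/-- PseudoUCB index of arm `ℓ` at round `t` (rewards in `[0,1]`): the minimum over `k` of
`φ̂_{ℓ,k} + √(2 log t / n_k)`. -/
def pseudoUCB (s : Fin K → Fin K → ℝ → ℝ) (z : Fin K → ℕ → ℝ) (n : Fin K → ℕ) (t : ℕ)
    (ℓ : Fin K) : ℝ :=
  ⨅ k : Fin K, (empPseudo s z n ℓ k + √(2 * Real.log t / n k))

/-- `k` is a maximiser of `f` over `S`; any way of breaking ties is allowed. -/
def IsArgmax (S : Finset (Fin K)) (f : Fin K → ℝ) (k : Fin K) : Prop :=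
  k ∈ S ∧ ∀ j ∈ S, f j ≤ f k

/-- A run of C-LUCB with confidence parameter `δ` on the reward table `z`. Every arm is sampled
once before round `1`; `count t` and `active t` are the sample counts and the active set at the
start of round `t ≥ 1`. While at least two arms are active, round `t` samples the two arms
`m₁ t`, `m₂ t`; afterwards every active arm whose CrossUCB index is smaller than the largest lower
confidence index of an active arm is removed. -/
structure Run (B : ℕ → ℝ → ℝ) (s : Fin K → Fin K → ℝ → ℝ) (δ : ℝ) (z : Fin K → ℕ → ℝ) where
  active : ℕ → Finset (Fin K)
  count : ℕ → Fin K → ℕ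
  m₁ : ℕ → Fin K
  m₂ : ℕ → Fin K
  active_one : active 1 = Finset.univ
  count_one : ∀ k, count 1 k = 1
  m₁_spec : ∀ t, 1 ≤ t → 2 ≤ (active t).card →
    IsArgmax (active t) (pseudoUCB s z (count t) t) (m₁ t)
  m₂_spec : ∀ t, 1 ≤ t → 2 ≤ (active t).card →
    IsArgmax ((active t).erase (m₁ t))
      (fun k => min (crossUCB₂ B s z (count t) (δ / (2 * K)) k k) (pseudoUCB s z (count t) t k))
      (m₂ t)
  count_succ : ∀ t, 1 ≤ t → ∀ k, count (t + 1) k =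
    if 2 ≤ (active t).card ∧ (k = m₁ t ∨ k = m₂ t) then count t k + 1 else count t k
  active_succ : ∀ t, 1 ≤ t → ∀ k, k ∈ active (t + 1) ↔
    k ∈ active t ∧ ¬ ∃ ℓ ∈ active t,
      crossUCB B s z (count (t + 1)) (δ / (2 * K)) k < lcb B z (count (t + 1)) (δ / (2 * K)) ℓ

/-- C-LUCB can be run on every reward table. -/
theorem exists_run (hK : 0 < K) (B : ℕ → ℝ → ℝ) (s : Fin K → Fin K → ℝ → ℝ) (δ : ℝ)
    (z : Fin K → ℕ → ℝ) : Nonempty (Run B s δ z) := by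
  classical
  have argmax : ∀ (S : Finset (Fin K)) (f : Fin K → ℝ), S.Nonempty → ∃ k, IsArgmax S f k :=
    fun S f h => (S.exists_max_image f h).imp fun k hk => ⟨hk.1, hk.2⟩
  have sel : ∀ (t : ℕ) (A : Finset (Fin K)) (n : Fin K → ℕ), ∃ m : Fin K × Fin K, 2 ≤ A.card →
      IsArgmax A (pseudoUCB s z n t) m.1 ∧
      IsArgmax (A.erase m.1)
        (fun k => min (crossUCB₂ B s z n (δ / (2 * K)) k k) (pseudoUCB s z n t k)) m.2 := by
    intro t A n
    by_cases h : 2 ≤ A.card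
    · obtain ⟨a, ha⟩ := argmax A (pseudoUCB s z n t) (Finset.card_pos.mp (by omega))
      obtain ⟨b, hb⟩ := argmax (A.erase a)
        (fun k => min (crossUCB₂ B s z n (δ / (2 * K)) k k) (pseudoUCB s z n t k))
        (Finset.card_pos.mp (by rw [Finset.card_erase_of_mem ha.1]; omega))
      exact ⟨(a, b), fun _ => ⟨ha, hb⟩⟩
    · exact ⟨(⟨0, hK⟩, ⟨0, hK⟩), fun h' => absurd h' h⟩
  choose m hm using sel
  let cnt : ℕ → Finset (Fin K) → (Fin K → ℕ) → Fin K → ℕ := fun t A n k =>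
    if 2 ≤ A.card ∧ (k = (m t A n).1 ∨ k = (m t A n).2) then n k + 1 else n k
  let act : Finset (Fin K) → (Fin K → ℕ) → Finset (Fin K) := fun A n =>
    A.filter fun k => ¬ ∃ ℓ ∈ A,
      crossUCB B s z n (δ / (2 * K)) k < lcb B z n (δ / (2 * K)) ℓ
  let st : ℕ → Finset (Fin K) × (Fin K → ℕ) := fun t =>
    Nat.rec (Finset.univ, fun _ => 1)
      (fun i x => (act x.1 (cnt (i + 1) x.1 x.2), cnt (i + 1) x.1 x.2)) t
  refine ⟨⟨fun t => (st (t - 1)).1, fun t => (st (t - 1)).2,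
    fun t => (m t (st (t - 1)).1 (st (t - 1)).2).1, fun t => (m t (st (t - 1)).1 (st (t - 1)).2).2,
    rfl, fun _ => rfl, fun t _ h => (hm t _ _ h).1, fun t _ h => (hm t _ _ h).2, ?_, ?_⟩⟩
  · intro t ht k
    obtain ⟨u, rfl⟩ : ∃ u, t = u + 1 := ⟨t - 1, by omega⟩
    rfl
  · intro t ht k
    obtain ⟨u, rfl⟩ : ∃ u, t = u + 1 := ⟨t - 1, by omega⟩
    exact Finset.mem_filter

namespace Run

variable {B : ℕ → ℝ → ℝ} {s : Fin K → Fin K → ℝ → ℝ} {δ : ℝ} {z : Fin K → ℕ → ℝ}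

/-- The run stops at the start of round `T` (i.e. after rounds `1, …, T - 1`): for the first time
exactly one arm is active. A run in which all arms get removed at once never stops. -/
def StopsAt (R : Run B s δ z) (T : ℕ) : Prop :=
  1 ≤ T ∧ (R.active T).card = 1 ∧ ∀ t, 1 ≤ t → t < T → (R.active t).card ≠ 1

/-- Number of samples drawn before round `T`, the initial ones included. -/
def samples (R : Run B s δ z) (T : ℕ) : ℕ := ∑ k, R.count T k

open Classical in
/-- Number of rounds before round `T` in which a non-competitive arm is sampled and the other
sampled arm is not `kstar`. -/
def roundsNC (R : Run B s δ z) (C : Finset (Fin K)) (kstar : Fin K) (T : ℕ) : ℕ :=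
  ((Finset.Ico 1 T).filter fun t =>
    (R.m₁ t ∉ C ∧ R.m₂ t ≠ kstar) ∨ (R.m₂ t ∉ C ∧ R.m₁ t ≠ kstar)).card

open Classical in
/-- Number of rounds before round `T` in which the PseudoUCB index of `kstar` is below the mean
`μstar` of `kstar`. -/
def roundsR (R : Run B s δ z) (kstar : Fin K) (μstar : ℝ) (T : ℕ) : ℕ :=
  ((Finset.Ico 1 T).filter fun t => pseudoUCB s z (R.count t) t kstar < μstar).card

end Run

end Algorithm

end CLUCB

end

/-! The proof separates a pathwise argument from probability. Fix a reward table on which the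
elimination bounds hold for all rewards and for the pseudo-rewards of k* (`Covered`), and on which
from round N + 1 on every average pseudo-reward is within √(2 log t / n) of its mean
(`ConcentratedAfter`).

On such a table k* is never removed, and after round N its index satisfies I_{k*} ≥ μ_{k*}. A later
round that misses k* samples an m₂ whose index also reaches μ_{k*}, which happens only while m₂ has
O(log t / Δ_{k*}²) samples. So k* is sampled in all but N + O(log t) rounds (`Run.le_count_kstar`).
Once t > 2N + M, with M fixed by the instance, the index relative to k* places every non-competitive
arm below μ_{k*}; such an arm can then be sampled only alongside k*.

From there each round is charged to a sampled competitive arm k with fewer than h_k samples, where n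
≥ h_k forces B(n, δ/2K) ≤ Δ_k/8 (`Run.exists_undersampled`). Otherwise an arm that should lose has
either beaten k* in the choice of m₂ or survived the previous elimination. Hence the run stops
within 2N + M + ∑ h_k rounds of two samples each.

For the probability, a union bound over 2K sequences makes `Covered` hold with probability 1 - δ.
Hoeffding's inequality gives failure probability O(u⁻³) for concentration in round u, so the last
failing round is dominated by an integrable variable independent of δ. Only union bounds are taken
across arms, so their joint dependence plays no role. -/

namespace CLUCB

variable {K : ℕ}

/-- Average pseudo-reward of arm `ℓ` over the first `n` samples of arm `k`. -/
noncomputable def pseudoAvg (s : Fin K → Fin K → ℝ → ℝ) (z : Fin K → ℕ → ℝ) (ℓ k : Fin K)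
    (n : ℕ) : ℝ :=
  (∑ i ∈ Finset.range n, s ℓ k (z k i)) / n

/-- The confidence bounds used by the elimination rule hold for the rewards of every arm and for
the pseudo-rewards of the arm `kstar`. -/
def Covered (B : ℕ → ℝ → ℝ) (s : Fin K → Fin K → ℝ → ℝ) (z : Fin K → ℕ → ℝ)
    (φ : Fin K → Fin K → ℝ) (kstar : Fin K) (ε : ℝ) : Prop :=
  ∀ k n, 1 ≤ n → |pseudoAvg s z k k n - φ k k| ≤ B n ε ∧
    |pseudoAvg s z kstar k n - φ kstar k| ≤ B n ε

/-- From round `N + 1` on, all average pseudo-rewards are within the width of the PseudoUCB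
index of their expectations. -/
def ConcentratedAfter (s : Fin K → Fin K → ℝ → ℝ) (z : Fin K → ℕ → ℝ)
    (φ : Fin K → Fin K → ℝ) (N : ℕ) : Prop :=
  ∀ t, N < t → ∀ ℓ k n, 1 ≤ n → n ≤ t → |pseudoAvg s z ℓ k n - φ ℓ k| ≤ √(2 * Real.log t / n)

/-- The relations between expected pseudo-rewards `φ`, competitive arms `C` and gaps `Δ`. -/
structure IsGapProfile (φ : Fin K → Fin K → ℝ) (kstar : Fin K) (C : Finset (Fin K))
    (Δ : Fin K → ℝ) : Prop where
  pos : 0 < Δ kstar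
  min_le : ∀ k, Δ kstar ≤ Δ k
  add_le : ∀ k, k ≠ kstar → φ k k + Δ k ≤ φ kstar kstar
  le_cross : ∀ k, φ kstar kstar ≤ φ kstar k
  mem : kstar ∈ C
  cross_add_le : ∀ ℓ, ℓ ∉ C → φ ℓ kstar + Δ kstar ≤ φ kstar kstar

theorem pseudoUCB_le (s : Fin K → Fin K → ℝ → ℝ) (z : Fin K → ℕ → ℝ) (n : Fin K → ℕ) (t : ℕ)
    (ℓ k : Fin K) :
    pseudoUCB s z n t ℓ ≤ pseudoAvg s z ℓ k (n k) + √(2 * Real.log t / n k) :=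
  ciInf_le (f := fun k => empPseudo s z n ℓ k + √(2 * Real.log t / n k))
    (Set.finite_range _).bddBelow k

theorem crossUCB_le (B : ℕ → ℝ → ℝ) (s : Fin K → Fin K → ℝ → ℝ) (z : Fin K → ℕ → ℝ)
    (n : Fin K → ℕ) (ε : ℝ) (ℓ k : Fin K) :
    crossUCB B s z n ε ℓ ≤ pseudoAvg s z ℓ k (n k) + B (n k) ε :=
  ciInf_le (f := fun k => crossUCB₂ B s z n ε ℓ k) (Set.finite_range _).bddBelow k

theorem le_div_sq_of_le_sqrt {a d : ℝ} {n : ℕ} (hn : 1 ≤ n) (hd : 0 < d) (ha : 0 ≤ a)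
    (h : d ≤ √(a / n)) : (n : ℝ) ≤ a / d ^ 2 := by
  have hn' : (0 : ℝ) < n := by exact_mod_cast hn
  have h2 : d ^ 2 ≤ a / n := by
    have := pow_le_pow_left₀ hd.le h 2
    rwa [Real.sq_sqrt (by positivity)] at this
  rw [le_div_iff₀ hn'] at h2
  rw [le_div_iff₀ (by positivity)]
  linarith

/-! ### Pathwise analysis of a run on a well-behaved reward table. -/

namespace Run

variable {B : ℕ → ℝ → ℝ} {s : Fin K → Fin K → ℝ → ℝ} {δ : ℝ} {z : Fin K → ℕ → ℝ}
  {φ : Fin K → Fin K → ℝ} {kstar : Fin K} {C : Finset (Fin K)} {Δ : Fin K → ℝ} {N : ℕ}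

theorem one_le_count (R : Run B s δ z) {t : ℕ} (ht : 1 ≤ t) (k : Fin K) : 1 ≤ R.count t k := by
  induction t, ht using Nat.le_induction with
  | base => rw [R.count_one]
  | succ t ht ih => rw [R.count_succ t ht]; split_ifs <;> omega

theorem count_le (R : Run B s δ z) {t : ℕ} (ht : 1 ≤ t) (k : Fin K) : R.count t k ≤ t := by
  induction t, ht using Nat.le_induction with
  | base => rw [R.count_one]
  | succ t ht ih => rw [R.count_succ t ht]; split_ifs <;> omega

theorem empMean_eq (hs : ∀ k r, s k k r = r) (n : Fin K → ℕ) (k : Fin K) :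
    empMean z n k = pseudoAvg s z k k (n k) := by
  simp [empMean, pseudoAvg, hs]

/-- Every cross index of k* stays above μ_{k*}, because its pseudo-rewards have mean at least
μ_{k*}, while no lower index exceeds the mean of its own arm. -/
theorem kstar_mem_active (R : Run B s δ z) (hs : ∀ k r, s k k r = r)
    (hφ : IsGapProfile φ kstar C Δ) (hE : Covered B s z φ kstar (δ / (2 * K)))
    {t : ℕ} (ht : 1 ≤ t) : kstar ∈ R.active t := by
  have : Nonempty (Fin K) := ⟨kstar⟩
  induction t, ht using Nat.le_induction with
  | base => rw [R.active_one]; exact Finset.mem_univ _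
  | succ t ht ih =>
    rw [R.active_succ t ht]
    refine ⟨ih, ?_⟩
    rintro ⟨ℓ, -, hlt⟩
    have h1 : φ kstar kstar ≤ crossUCB B s z (R.count (t + 1)) (δ / (2 * K)) kstar := by
      refine le_ciInf fun k => ?_
      have := (abs_le.1 (hE k _ (R.one_le_count (by omega : 1 ≤ t + 1) k)).2).1
      have h2 := hφ.le_cross k
      change _ ≤ pseudoAvg s z kstar k (R.count (t + 1) k) + _
      linarith
    have h2 : lcb B z (R.count (t + 1)) (δ / (2 * K)) ℓ ≤ φ ℓ ℓ := by
      have := (abs_le.1 (hE ℓ _ (R.one_le_count (by omega : 1 ≤ t + 1) ℓ)).1).2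
      rw [lcb, empMean_eq hs]
      linarith
    have h3 : φ ℓ ℓ ≤ φ kstar kstar := by
      by_cases h : ℓ = kstar
      · rw [h]
      · linarith [hφ.add_le ℓ h, hφ.pos, hφ.min_le ℓ]
    linarith

theorem le_pseudoUCB (R : Run B s δ z) (hφ : IsGapProfile φ kstar C Δ)
    (hN : ConcentratedAfter s z φ N) {t : ℕ} (ht : N < t) :
    φ kstar kstar ≤ pseudoUCB s z (R.count t) t kstar := by
  have : Nonempty (Fin K) := ⟨kstar⟩
  have ht1 : 1 ≤ t := by omega
  refine le_ciInf fun k => ?_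
  have := (abs_le.1 (hN t ht kstar k _ (R.one_le_count ht1 k) (R.count_le ht1 k))).1
  have h2 := hφ.le_cross k
  change _ ≤ pseudoAvg s z kstar k (R.count t k) + _
  linarith

/-- When k* is not m₁ it is still a candidate for m₂, so both sampled arms beat indices of k* that
are at least μ_{k*}. -/
theorem le_index_of_not_sampled (R : Run B s δ z) (hs : ∀ k r, s k k r = r)
    (hφ : IsGapProfile φ kstar C Δ) (hE : Covered B s z φ kstar (δ / (2 * K)))
    (hN : ConcentratedAfter s z φ N) {t : ℕ} (ht : N < t) (hc : 2 ≤ (R.active t).card)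
    (h₁ : R.m₁ t ≠ kstar) :
    φ kstar kstar ≤ pseudoUCB s z (R.count t) t (R.m₁ t) ∧
    φ kstar kstar ≤ pseudoUCB s z (R.count t) t (R.m₂ t) ∧
    φ kstar kstar ≤ pseudoAvg s z (R.m₂ t) (R.m₂ t) (R.count t (R.m₂ t))
      + B (R.count t (R.m₂ t)) (δ / (2 * K)) := by
  have ht1 : 1 ≤ t := by omega
  have hmem := R.kstar_mem_active hs hφ hE ht1
  have hI := R.le_pseudoUCB hφ hN ht
  have hU : φ kstar kstar ≤ crossUCB₂ B s z (R.count t) (δ / (2 * K)) kstar kstar := by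
    have := (abs_le.1 (hE kstar _ (R.one_le_count ht1 kstar)).1).1
    change _ ≤ pseudoAvg s z kstar kstar (R.count t kstar) + _
    linarith
  have hm2 := (R.m₂_spec t ht1 hc).2 kstar (Finset.mem_erase.2 ⟨h₁.symm, hmem⟩)
  have hm := le_trans (le_min hU hI) hm2
  rw [le_min_iff] at hm
  exact ⟨hI.trans ((R.m₁_spec t ht1 hc).2 kstar hmem), hm.2, hm.1⟩

open Classical in
-- The charging device: each counted round raises the sample count of `k`, so an arm can be charged
-- at most `H` times before its count reaches `H`.
theorem card_sampled_le (R : Run B s δ z) (k : Fin K) (H t : ℕ) (ht : 1 ≤ t) :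
    ((Finset.Ico 1 t).filter fun u => (2 ≤ (R.active u).card ∧ (k = R.m₁ u ∨ k = R.m₂ u)) ∧
      R.count u k < H).card ≤ min (R.count t k) H := by
  induction t, ht using Nat.le_induction with
  | base => simp
  | succ t ht ih =>
    rw [← Finset.insert_Ico_right_eq_Ico_add_one ht, Finset.filter_insert, R.count_succ t ht]
    rw [le_min_iff] at ih ⊢
    split_ifs with h1 h2 h2
    · rw [Finset.card_insert_of_notMem (by simp)]
      omega
    · exact absurd h1.1 h2
    · omega
    · exact ih

open Classical in
theorem le_count_kstar (R : Run B s δ z) (hs : ∀ k r, s k k r = r)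
    (hφ : IsGapProfile φ kstar C Δ) (hE : Covered B s z φ kstar (δ / (2 * K)))
    (hN : ConcentratedAfter s z φ N) {t : ℕ} (ht : 1 ≤ t)
    (hc : ∀ u, 1 ≤ u → u < t → 2 ≤ (R.active u).card) :
    t ≤ 1 + R.count t kstar + N + K * (⌊8 * Real.log t / Δ kstar ^ 2⌋₊ + 1) := by
  set H := ⌊8 * Real.log t / Δ kstar ^ 2⌋₊ + 1 with hH
  let F : Fin K → ℕ → Finset ℕ := fun k H =>
    (Finset.Ico 1 t).filter fun u => (2 ≤ (R.active u).card ∧ (k = R.m₁ u ∨ k = R.m₂ u)) ∧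
      R.count u k < H
  have hsub : Finset.Ico 1 t ⊆ F kstar t ∪ Finset.Icc 1 N ∪ Finset.univ.biUnion (fun k => F k H) := by
    intro u hu
    obtain ⟨hu1, hut⟩ := Finset.mem_Ico.1 hu
    have hcu := hc u hu1 hut
    by_cases hk : kstar = R.m₁ u ∨ kstar = R.m₂ u
    -- The cutoff `t` is vacuous here, since counts never exceed the round number: `F kstar t`
    -- consists of all rounds that sample k*.
    · refine Finset.mem_union_left _ (Finset.mem_union_left _ (Finset.mem_filter.2 ⟨hu, ⟨hcu, hk⟩, ?_⟩))
      exact (R.count_le hu1 _).trans_lt hut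
    by_cases huN : u ≤ N
    · exact Finset.mem_union_left _ (Finset.mem_union_right _ (Finset.mem_Icc.2 ⟨hu1, huN⟩))
    refine Finset.mem_union_right _ (Finset.mem_biUnion.2 ⟨R.m₂ u, Finset.mem_univ _,
      Finset.mem_filter.2 ⟨hu, ⟨hcu, Or.inr rfl⟩, ?_⟩⟩)
    push Not at hk huN
    have h1 := (R.le_index_of_not_sampled hs hφ hE hN huN hcu hk.1.symm).2.1
    set j := R.m₂ u
    have h2 := pseudoUCB_le s z (R.count u) u j j
    have h3 := (abs_le.1 (hN u huN j j _ (R.one_le_count hu1 j) (R.count_le hu1 j))).2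
    have h4 := hφ.add_le j hk.2.symm
    have h5 := hφ.min_le j
    have hlog : 0 ≤ Real.log u := Real.log_natCast_nonneg u
    -- The index of `j` exceeds its mean by at most two widths, yet reaches μ_{k*} ≥ μ_j + Δ_j; so
    -- one width is at least half the gap.
    have h6 : Δ kstar / 2 ≤ √(2 * Real.log u / R.count u j) := by linarith
    have h7 := le_div_sq_of_le_sqrt (R.one_le_count hu1 j) (half_pos hφ.pos)
      (by positivity) h6
    have h8 : 2 * Real.log u / (Δ kstar / 2) ^ 2 ≤ 8 * Real.log t / Δ kstar ^ 2 := by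
      rw [show 2 * Real.log u / (Δ kstar / 2) ^ 2 = 8 * Real.log u / Δ kstar ^ 2 by
        ring]
      have : Real.log u ≤ Real.log t :=
        Real.log_le_log (by exact_mod_cast hu1) (by exact_mod_cast hut.le)
      gcongr
    exact Nat.lt_succ_of_le (Nat.le_floor (h7.trans h8))
  have h1 := Finset.card_le_card hsub
  have h2 := Finset.card_union_le (F kstar t ∪ Finset.Icc 1 N) (Finset.univ.biUnion (fun k => F k H))
  have h3 := Finset.card_union_le (F kstar t) (Finset.Icc 1 N)
  have h4 : (Finset.univ.biUnion (fun k => F k H)).card ≤ K * H := by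
    refine (Finset.card_biUnion_le_card_mul _ _ H fun k _ => ?_).trans (by simp)
    exact (R.card_sampled_le k H t ht).trans (min_le_right _ _)
  have h5 : (F kstar t).card ≤ R.count t kstar :=
    (R.card_sampled_le kstar t t ht).trans (min_le_left _ _)
  simp only [Nat.card_Ico, Nat.card_Icc] at h1 h3
  omega

/-- For `t` at least `M`, the logarithmic terms of the sample counts are negligible. -/
def LogNegligible (K : ℕ) (Δ : ℝ) (M : ℕ) : Prop :=
  ∀ t : ℕ, M ≤ t → 1 + K * (8 * Real.log t / Δ ^ 2 + 1) + 128 * Real.log t / Δ ^ 2 ≤ (t : ℝ) / 2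

/-- Since N < t/2 and the logarithmic losses use at most the other half of t, at least 128 log t /
Δ_{k*}² samples of k* remain. -/
theorem sqrt_count_kstar_le (R : Run B s δ z) (hs : ∀ k r, s k k r = r)
    (hφ : IsGapProfile φ kstar C Δ) (hE : Covered B s z φ kstar (δ / (2 * K)))
    (hN : ConcentratedAfter s z φ N) {M : ℕ} (hM : LogNegligible K (Δ kstar) M)
    {t : ℕ} (ht : 2 * N + M < t) (hc : ∀ u, 1 ≤ u → u < t → 2 ≤ (R.active u).card) :
    √(2 * Real.log t / R.count t kstar) ≤ Δ kstar / 8 := by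
  have ht1 : 1 ≤ t := by omega
  have h1 : (t : ℝ) ≤ 1 + R.count t kstar + N + K * (⌊8 * Real.log t / Δ kstar ^ 2⌋₊ + 1) := by
    exact_mod_cast R.le_count_kstar hs hφ hE hN ht1 hc
  have hlog : 0 ≤ Real.log t := Real.log_natCast_nonneg t
  have h2 : (⌊8 * Real.log t / Δ kstar ^ 2⌋₊ : ℝ) ≤ 8 * Real.log t / Δ kstar ^ 2 :=
    Nat.floor_le (by positivity)
  have h3 : (K : ℝ) * (⌊8 * Real.log t / Δ kstar ^ 2⌋₊ + 1)
      ≤ K * (8 * Real.log t / Δ kstar ^ 2 + 1) := by gcongr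
  have h4 := hM t (by omega)
  have h5 : (2 * N + M : ℝ) < t := by exact_mod_cast ht
  have hM0 : (0 : ℝ) ≤ M := by positivity
  have h6 : 128 * Real.log t / Δ kstar ^ 2 ≤ R.count t kstar := by linarith
  have hpos : (0 : ℝ) < R.count t kstar := by exact_mod_cast R.one_le_count ht1 kstar
  have hΔ := hφ.pos
  rw [Real.sqrt_le_left (by positivity), div_le_iff₀ hpos]
  rw [div_le_iff₀ (by positivity)] at h6
  nlinarith

/-- A non-competitive ℓ has I_ℓ ≤ φ_{ℓ,k*} + 2·Δ_{k*}/8 < μ_{k*}, too small to be chosen over k*. -/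
theorem mem_competitive_of_not_sampled (R : Run B s δ z) (hs : ∀ k r, s k k r = r)
    (hφ : IsGapProfile φ kstar C Δ) (hE : Covered B s z φ kstar (δ / (2 * K)))
    (hN : ConcentratedAfter s z φ N) {M : ℕ} (hM : LogNegligible K (Δ kstar) M)
    {t : ℕ} (ht : 2 * N + M < t) (hc : ∀ u, 1 ≤ u → u ≤ t → 2 ≤ (R.active u).card)
    (h₁ : R.m₁ t ≠ kstar) : R.m₁ t ∈ C ∧ R.m₂ t ∈ C := by
  have ht1 : 1 ≤ t := by omega
  have htN : N < t := by omega
  have hI := R.le_index_of_not_sampled hs hφ hE hN htN (hc t ht1 le_rfl) h₁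
  have hsq := R.sqrt_count_kstar_le hs hφ hE hN hM ht fun u h h' => hc u h h'.le
  have key : ∀ ℓ, φ kstar kstar ≤ pseudoUCB s z (R.count t) t ℓ → ℓ ∈ C := by
    intro ℓ hℓ
    by_contra hC
    have h2 := pseudoUCB_le s z (R.count t) t ℓ kstar
    have h3 := (abs_le.1 (hN t htN ℓ kstar _ (R.one_le_count ht1 kstar) (R.count_le ht1 kstar))).2
    have h4 := hφ.cross_add_le ℓ hC
    have := hφ.pos
    linarith
  exact ⟨key _ hI.1, key _ hI.2.1⟩

/-- If k* is missed, a well-sampled m₂ would have upper bound at most μ_{m₂} + Δ_{m₂}/4 < μ_{k*}. If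
k* is sampled and already well sampled, its partner survived the last elimination, which a
non-competitive or well-sampled arm could not have done. -/
theorem exists_undersampled (R : Run B s δ z) (hs : ∀ k r, s k k r = r)
    (hφ : IsGapProfile φ kstar C Δ) (hE : Covered B s z φ kstar (δ / (2 * K)))
    (hN : ConcentratedAfter s z φ N) {M : ℕ} (hM : LogNegligible K (Δ kstar) M) (hM1 : 1 ≤ M)
    {h : Fin K → ℕ} (hh : ∀ k n, h k ≤ n → B n (δ / (2 * K)) ≤ Δ k / 8)
    {t : ℕ} (ht : 2 * N + M < t) (hc : ∀ u, 1 ≤ u → u ≤ t → 2 ≤ (R.active u).card) :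
    ∃ k ∈ C, (k = R.m₁ t ∨ k = R.m₂ t) ∧ R.count t k < h k := by
  have ht1 : 1 ≤ t := by omega
  have htN : N < t := by omega
  have hct := hc t ht1 le_rfl
  by_cases hk : R.m₁ t ≠ kstar ∧ R.m₂ t ≠ kstar
  · refine ⟨R.m₂ t, (R.mem_competitive_of_not_sampled hs hφ hE hN hM ht hc hk.1).2,
      Or.inr rfl, ?_⟩
    by_contra! hlt
    have h1 := (R.le_index_of_not_sampled hs hφ hE hN htN hct hk.1).2.2
    have h2 := (abs_le.1 (hE (R.m₂ t) _ (R.one_le_count ht1 (R.m₂ t))).1).2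
    have h3 := hφ.add_le _ hk.2
    have h4 := hh _ _ hlt
    have h5 := hφ.min_le (R.m₂ t)
    have h6 := hφ.pos
    linarith
  have hks : kstar = R.m₁ t ∨ kstar = R.m₂ t := by
    by_contra! hcon
    exact hk ⟨hcon.1.symm, hcon.2.symm⟩
  by_cases hlt : R.count t kstar < h kstar
  · exact ⟨kstar, hφ.mem, hks, hlt⟩
  push Not at hlt
  have hm1 := (R.m₁_spec t ht1 hct).1
  have hm2 := Finset.mem_erase.1 (R.m₂_spec t ht1 hct).1
  obtain ⟨j, hj, hjk, hja⟩ : ∃ j, (j = R.m₁ t ∨ j = R.m₂ t) ∧ j ≠ kstar ∧ j ∈ R.active t := by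
    rcases hks with h | h
    · exact ⟨R.m₂ t, Or.inr rfl, by rw [h]; exact hm2.1, hm2.2⟩
    · exact ⟨R.m₁ t, Or.inl rfl, by rw [h]; exact hm2.1.symm, hm1⟩
  -- The elimination ending round `u` uses the counts at the start of round `u + 1`. Since `M ≥ 1`,
  -- such a round `u ≥ 1` exists.
  obtain ⟨u, rfl⟩ : ∃ u, t = u + 1 := ⟨t - 1, by omega⟩
  have hu1 : 1 ≤ u := by omega
  have hnot := ((R.active_succ u hu1 j).1 hja).2
  push Not at hnot
  have hL := hnot kstar (R.kstar_mem_active hs hφ hE hu1)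
  rw [lcb, empMean_eq hs] at hL
  have h1 := (abs_le.1 (hE kstar _ (R.one_le_count ht1 kstar)).1).1
  have h2 := hh _ _ hlt
  have hpos := hφ.pos
  refine ⟨j, ?_, hj, ?_⟩
  -- `Covered` says nothing about the pseudo-rewards of `j` relative to k*; `ConcentratedAfter`
  -- controls them instead, which keeps the union bound at 2K sequences.
  · by_contra hC
    have h3 := crossUCB_le B s z (R.count (u + 1)) (δ / (2 * K)) j kstar
    have h4 := (abs_le.1 (hN _ htN j kstar _ (R.one_le_count ht1 kstar)
      (R.count_le ht1 kstar))).2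
    have h5 := R.sqrt_count_kstar_le hs hφ hE hN hM ht fun u h h' => hc u h h'.le
    have h6 := hφ.cross_add_le j hC
    linarith
  · by_contra! hge
    have h3 := crossUCB_le B s z (R.count (u + 1)) (δ / (2 * K)) j j
    have h4 := (abs_le.1 (hE j _ (R.one_le_count ht1 j)).1).2
    have h5 := hh _ _ hge
    have h6 := hφ.add_le j hjk
    have h7 := hφ.min_le j
    linarith

open Classical in
theorem rounds_le (R : Run B s δ z) (hs : ∀ k r, s k k r = r)
    (hφ : IsGapProfile φ kstar C Δ) (hE : Covered B s z φ kstar (δ / (2 * K)))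
    (hN : ConcentratedAfter s z φ N) {M : ℕ} (hM : LogNegligible K (Δ kstar) M) (hM1 : 1 ≤ M)
    {h : Fin K → ℕ} (hh : ∀ k n, h k ≤ n → B n (δ / (2 * K)) ≤ Δ k / 8)
    {t : ℕ} (ht : 1 ≤ t) (hc : ∀ u, 1 ≤ u → u < t → 2 ≤ (R.active u).card) :
    t ≤ 1 + (2 * N + M) + ∑ k ∈ C, h k := by
  let F : Fin K → Finset ℕ := fun k =>
    (Finset.Ico 1 t).filter fun u => (2 ≤ (R.active u).card ∧ (k = R.m₁ u ∨ k = R.m₂ u)) ∧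
      R.count u k < h k
  have hsub : Finset.Ico 1 t ⊆ Finset.Icc 1 (2 * N + M) ∪ C.biUnion F := by
    intro u hu
    obtain ⟨hu1, hut⟩ := Finset.mem_Ico.1 hu
    by_cases huN : u ≤ 2 * N + M
    · exact Finset.mem_union_left _ (Finset.mem_Icc.2 ⟨hu1, huN⟩)
    obtain ⟨k, hkC, hk, hlt⟩ := R.exists_undersampled hs hφ hE hN hM hM1 hh (not_le.1 huN)
      fun v h1 h2 => hc v h1 (h2.trans_lt hut)
    exact Finset.mem_union_right _ (Finset.mem_biUnion.2 ⟨k, hkC,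
      Finset.mem_filter.2 ⟨hu, ⟨hc u hu1 hut, hk⟩, hlt⟩⟩)
  have h1 := Finset.card_le_card hsub
  have h2 := Finset.card_union_le (Finset.Icc 1 (2 * N + M)) (C.biUnion F)
  have h3 : (C.biUnion F).card ≤ ∑ k ∈ C, h k :=
    Finset.card_biUnion_le.trans
      (Finset.sum_le_sum fun k _ => (R.card_sampled_le k (h k) t ht).trans (min_le_right _ _))
  simp only [Nat.card_Ico, Nat.card_Icc] at h1 h2
  omega

theorem samples_le (R : Run B s δ z) {t : ℕ} (ht : 1 ≤ t) :
    R.samples t + 2 ≤ K + 2 * t := by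
  induction t, ht using Nat.le_induction with
  | base => simp [samples, R.count_one]
  | succ t ht ih =>
    have h : R.samples (t + 1) ≤ R.samples t + 2 := by
      have h1 : ∀ k, R.count (t + 1) k ≤
          R.count t k + ((if k = R.m₁ t then 1 else 0) + (if k = R.m₂ t then 1 else 0)) := by
        intro k
        rw [R.count_succ t ht]
        split_ifs <;> simp_all
      refine (Finset.sum_le_sum fun k _ => h1 k).trans ?_
      simp [samples, Finset.sum_add_distrib]
    omega

theorem exists_stopsAt (R : Run B s δ z) (hs : ∀ k r, s k k r = r)
    (hφ : IsGapProfile φ kstar C Δ) (hE : Covered B s z φ kstar (δ / (2 * K)))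
    (hN : ConcentratedAfter s z φ N) {M : ℕ} (hM : LogNegligible K (Δ kstar) M) (hM1 : 1 ≤ M)
    {h : Fin K → ℕ} (hh : ∀ k n, h k ≤ n → B n (δ / (2 * K)) ≤ Δ k / 8) :
    ∃ T, R.StopsAt T ∧ R.roundsNC C kstar T ≤ 2 * N + M ∧ R.roundsR kstar (φ kstar kstar) T ≤ N ∧
      R.samples T ≤ K + 2 * (2 * N + M + ∑ k ∈ C, h k) := by
  classical
  -- The survival of k* excludes an empty active set, the one way to drop below two arms without
  -- stopping.
  have hcard : ∀ t, 1 ≤ t → (R.active t).card ≠ 1 → 2 ≤ (R.active t).card := by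
    intro t ht h1
    have := Finset.card_pos.2 ⟨kstar, R.kstar_mem_active hs hφ hE ht⟩
    omega
  have hex : ∃ t, 1 ≤ t ∧ (R.active t).card = 1 := by
    by_contra! hcon
    have := R.rounds_le hs hφ hE hN hM hM1 hh (t := 2 + (2 * N + M) + ∑ k ∈ C, h k) (by omega)
      fun u hu _ => hcard u hu (hcon u hu)
    omega
  obtain ⟨hT1, hT2⟩ := Nat.find_spec hex
  set T := Nat.find hex with hT
  have hmin : ∀ t, 1 ≤ t → t < T → (R.active t).card ≠ 1 := fun t h1 h2 h3 =>
    Nat.find_min hex h2 ⟨h1, h3⟩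
  have hc : ∀ t, 1 ≤ t → t < T → 2 ≤ (R.active t).card := fun t h1 h2 =>
    hcard t h1 (hmin t h1 h2)
  refine ⟨T, ⟨hT1, hT2, hmin⟩, ?_, ?_, ?_⟩
  · have : ∀ t ∈ (Finset.Ico 1 T).filter (fun t =>
        (R.m₁ t ∉ C ∧ R.m₂ t ≠ kstar) ∨ (R.m₂ t ∉ C ∧ R.m₁ t ≠ kstar)),
        t ∈ Finset.Icc 1 (2 * N + M) := by
      intro t ht
      obtain ⟨ht, hNC⟩ := Finset.mem_filter.1 ht
      obtain ⟨ht1, htT⟩ := Finset.mem_Ico.1 ht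
      refine Finset.mem_Icc.2 ⟨ht1, ?_⟩
      by_contra! hlt
      have hne : R.m₁ t ≠ kstar := by
        rcases hNC with h | h
        · exact fun h' => h.1 (h' ▸ hφ.mem)
        · exact h.2
      have := R.mem_competitive_of_not_sampled hs hφ hE hN hM hlt
        (fun u h1 h2 => hc u h1 (h2.trans_lt htT)) hne
      tauto
    refine le_trans (le_of_eq ?_) ((Finset.card_le_card this).trans (by simp))
    rfl
  · have : ∀ t ∈ (Finset.Ico 1 T).filter (fun t =>
        pseudoUCB s z (R.count t) t kstar < φ kstar kstar), t ∈ Finset.Icc 1 N := by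
      intro t ht
      obtain ⟨ht, hlt⟩ := Finset.mem_filter.1 ht
      refine Finset.mem_Icc.2 ⟨(Finset.mem_Ico.1 ht).1, ?_⟩
      by_contra! hNt
      exact absurd (R.le_pseudoUCB hφ hN hNt) (not_le.2 hlt)
    refine le_trans (le_of_eq ?_) ((Finset.card_le_card this).trans (by simp))
    rfl
  · have h1 := R.rounds_le hs hφ hE hN hM hM1 hh hT1 hc
    have h2 := R.samples_le hT1
    omega

end Run

end CLUCB

/-! ### Logarithmic estimates and sample thresholds. -/

namespace CLUCB

theorem exists_forall_add_mul_log_le (a b : ℝ) {κ : ℝ} (hκ : 0 < κ) :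
    ∃ M : ℕ, ∀ t : ℕ, M ≤ t → a + b * Real.log t ≤ κ * t := by
  have h1 : ∀ᶠ t : ℕ in Filter.atTop, ‖Real.log (t : ℝ)‖ ≤ κ / (2 * (|b| + 1)) * ‖(t : ℝ)‖ :=
    (Real.isLittleO_log_id_atTop.bound (by positivity : 0 < κ / (2 * (|b| + 1)))).natCast_atTop
  have h2 : ∀ᶠ t : ℕ in Filter.atTop, a / (κ / 2) ≤ (t : ℝ) :=
    tendsto_natCast_atTop_atTop.eventually_ge_atTop _
  obtain ⟨M, hM⟩ := Filter.eventually_atTop.1 (h1.and h2)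
  refine ⟨M, fun t ht => ?_⟩
  obtain ⟨h3, h4⟩ := hM t ht
  rw [div_le_iff₀ (by positivity)] at h4
  have ht0 : (0 : ℝ) ≤ t := t.cast_nonneg
  have h5 : b * Real.log t ≤ |b| * ‖Real.log (t : ℝ)‖ := by
    rw [Real.norm_eq_abs, ← abs_mul]
    exact le_abs_self _
  have h6 : |b| * ‖Real.log (t : ℝ)‖ ≤ (|b| + 1) * (κ / (2 * (|b| + 1)) * t) := by
    rw [Real.norm_of_nonneg ht0] at h3
    gcongr
    linarith
  have h7 : (|b| + 1) * (κ / (2 * (|b| + 1)) * t) = κ / 2 * t := by field_simp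
  linarith

theorem exists_logNegligible (K : ℕ) (Δ : ℝ) :
    ∃ M, 1 ≤ M ∧ Run.LogNegligible K Δ M := by
  obtain ⟨M, hM⟩ := exists_forall_add_mul_log_le (1 + K) (K * (8 / Δ ^ 2) + 128 / Δ ^ 2)
    (half_pos one_pos)
  refine ⟨M + 1, by omega, fun t ht => ?_⟩
  have := hM t (by omega)
  have h : 1 + K * (8 * Real.log t / Δ ^ 2 + 1) + 128 * Real.log t / Δ ^ 2
      = 1 + K + (K * (8 / Δ ^ 2) + 128 / Δ ^ 2) * Real.log t := by ring
  linarith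

theorem exists_bound_le {B : ℕ → ℝ → ℝ} {c : ℝ} (hc : 1 ≤ c)
    (hB : ∀ n : ℕ, 3 ≤ n → ∀ δ : ℝ, 0 < δ → δ < 1 →
      B n δ ≤ c * √(Real.log (Real.log n / δ) / n)) {K : ℕ} (hK : 1 ≤ K) {Δ : ℝ} (hΔ : 0 < Δ) :
    ∃ n₀ : ℕ, ∀ δ : ℝ, 0 < δ → δ < 1 → ∀ n : ℕ,
      128 * c ^ 2 / Δ ^ 2 * Real.log (1 / δ) + n₀ ≤ n → B n (δ / (2 * K)) ≤ Δ / 8 := by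
  -- With κ this value, (Δ / 8c)² = 2κ. One share κn absorbs log log n + log 2K for n beyond a
  -- threshold free of δ; the other absorbs log(1/δ).
  have hκ : 0 < Δ ^ 2 / (128 * c ^ 2) := by positivity
  obtain ⟨M, hM⟩ := exists_forall_add_mul_log_le (Real.log (2 * K)) 1 hκ
  refine ⟨M + 3, fun δ hδ hδ1 n hn => ?_⟩
  have hK' : (1 : ℝ) ≤ K := by exact_mod_cast hK
  have hx : 0 < Real.log (1 / δ) := Real.log_pos (by rw [lt_div_iff₀ hδ]; linarith)
  have hx0 : 0 ≤ 128 * c ^ 2 / Δ ^ 2 * Real.log (1 / δ) := by positivity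
  have hnM : M + 3 ≤ n := by
    have : ((M + 3 : ℕ) : ℝ) ≤ n := by linarith
    exact_mod_cast this
  have hn3 : (3 : ℝ) ≤ n := by exact_mod_cast (by omega : 3 ≤ n)
  have hlog : 0 < Real.log n := Real.log_pos (by linarith)
  have h1 : Real.log (Real.log n / (δ / (2 * K)))
      = Real.log (Real.log n) + Real.log (2 * K) + Real.log (1 / δ) := by
    rw [← Real.log_mul hlog.ne' (by positivity), ← Real.log_mul (by positivity) (by positivity)]
    congr 1
    field_simp
  have h2 := Real.log_le_self hlog.le
  have h3 := hM n (by omega)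
  have h4 : Real.log (1 / δ) ≤ Δ ^ 2 / (128 * c ^ 2) * n := by
    have : 128 * c ^ 2 / Δ ^ 2 * Real.log (1 / δ) ≤ n := by
      have : (0 : ℝ) ≤ ((M + 3 : ℕ) : ℝ) := Nat.cast_nonneg _
      linarith
    calc Real.log (1 / δ)
        = Δ ^ 2 / (128 * c ^ 2) * (128 * c ^ 2 / Δ ^ 2 * Real.log (1 / δ)) := by field_simp
      _ ≤ _ := by gcongr
  have h5 : Real.log (Real.log n / (δ / (2 * K))) / n ≤ (Δ / (8 * c)) ^ 2 := by
    rw [h1, div_le_iff₀ (by linarith)]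
    have : (Δ / (8 * c)) ^ 2 = 2 * (Δ ^ 2 / (128 * c ^ 2)) := by field_simp; norm_num
    rw [this]
    linarith
  have hε1 : δ / (2 * K) < 1 := by
    rw [div_lt_one (by positivity)]
    linarith
  refine (hB n (by omega) _ (by positivity) hε1).trans ?_
  have h6 := (Real.sqrt_le_left (by positivity)).2 h5
  calc c * √(Real.log (Real.log n / (δ / (2 * K))) / n) ≤ c * (Δ / (8 * c)) := by gcongr
    _ = Δ / 8 := by field_simp

/-! ### Hoeffding's inequality, last failure times, and transfer of the coverage property. -/

section Probability

variable {Ω : Type*} {mΩ : MeasurableSpace Ω} {P : Measure Ω} [IsProbabilityMeasure P]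

theorem measure_lt_abs_avg_sub_le {X : ℕ → Ω → ℝ} (hX : ∀ i, Measurable (X i))
    (hind : iIndepFun X P) (hb : ∀ i, ∀ᵐ ω ∂P, X i ω ∈ Set.Icc (0 : ℝ) 1) {m : ℝ}
    (hm : ∀ i, ∫ ω, X i ω ∂P = m) {n : ℕ} (hn : 1 ≤ n) {w : ℝ} (hw : 0 ≤ w) :
    P.real {ω | w < |(∑ i ∈ Finset.range n, X i ω) / n - m|}
      ≤ 2 * Real.exp (-2 * n * w ^ 2) := by
  have hn' : (0 : ℝ) < n := by exact_mod_cast hn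
  have hsub : ∀ i, HasSubgaussianMGF (fun ω => X i ω - m) ((‖(1 : ℝ) - 0‖₊ / 2) ^ 2) P := by
    intro i
    have := hasSubgaussianMGF_of_mem_Icc (hX i).aemeasurable (hb i)
    rwa [hm i] at this
  have hsub' : ∀ i, HasSubgaussianMGF (fun ω => -(X i ω - m)) ((‖(1 : ℝ) - 0‖₊ / 2) ^ 2) P :=
    fun i => (hsub i).neg
  have hi1 : iIndepFun (fun i ω => X i ω - m) P :=
    hind.comp (fun _ x => x - m) fun _ => measurable_id.sub_const m
  have hi2 : iIndepFun (fun i ω => -(X i ω - m)) P :=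
    hind.comp (fun _ x => -(x - m)) fun _ => (measurable_id.sub_const m).neg
  have h1 := HasSubgaussianMGF.measure_sum_range_ge_le_of_iIndepFun hi1 (n := n)
    (fun i _ => hsub i) (mul_nonneg hn'.le hw)
  have h2 := HasSubgaussianMGF.measure_sum_range_ge_le_of_iIndepFun hi2 (n := n)
    (fun i _ => hsub' i) (mul_nonneg hn'.le hw)
  have hexp : Real.exp (-(n * w) ^ 2 / (2 * n * (((‖(1 : ℝ) - 0‖₊ / 2) ^ 2 : NNReal) : ℝ)))
      = Real.exp (-2 * n * w ^ 2) := by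
    congr 1
    simp
    field_simp
  rw [hexp] at h1 h2
  have hsubset : {ω | w < |(∑ i ∈ Finset.range n, X i ω) / n - m|} ⊆
      {ω | n * w ≤ ∑ i ∈ Finset.range n, (X i ω - m)} ∪
      {ω | n * w ≤ ∑ i ∈ Finset.range n, -(X i ω - m)} := by
    intro ω hω
    simp only [Set.mem_ofPred_eq, Set.mem_union, Finset.sum_neg_distrib, Finset.sum_sub_distrib,
      Finset.sum_const, Finset.card_range, nsmul_eq_mul] at hω ⊢
    have h : ∑ i ∈ Finset.range n, X i ω - n * m
        = n * ((∑ i ∈ Finset.range n, X i ω) / n - m) := by field_simp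
    rw [h]
    rcases lt_abs.1 hω with h' | h'
    · exact Or.inl (by gcongr)
    · refine Or.inr ?_
      rw [← mul_neg]
      gcongr
  calc _ ≤ _ := measureReal_mono hsubset
    _ ≤ _ := measureReal_union_le _ _
    _ ≤ _ := by linarith

/-- Take τ = ∑ u·1_{A_u}: it dominates each index u whose event occurs, and its expectation is at
most ∑ c/u². -/
theorem exists_integrable_last_le {A : ℕ → Set Ω} (hA : ∀ u, MeasurableSet (A u)) {c : ℝ}
    (hP : ∀ u, 1 ≤ u → P.real (A u) ≤ c / (u : ℝ) ^ 3) :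
    ∃ τ : Ω → ℝ, Integrable τ P ∧ (∀ ω, 0 ≤ τ ω) ∧
      ∀ᵐ ω ∂P, ∀ u : ℕ, ω ∈ A u → (u : ℝ) ≤ τ ω := by
  let f : Ω → ENNReal := fun ω => ∑' u : ℕ, (A u).indicator (fun _ => (u : ENNReal)) ω
  have hmeas : ∀ u : ℕ, Measurable ((A u).indicator (fun _ => (u : ENNReal))) := fun u =>
    measurable_const.indicator (hA u)
  have hf : Measurable f := Measurable.tsum hmeas
  have hc : ∀ u : ℕ, (u : ENNReal) * P (A u) ≤ ENNReal.ofReal (c / (u : ℝ) ^ 2) := by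
    intro u
    rcases Nat.eq_zero_or_pos u with rfl | hu
    · simp
    have hu' : (0 : ℝ) < u := by exact_mod_cast hu
    rw [← ofReal_measureReal, ← ENNReal.ofReal_natCast, ← ENNReal.ofReal_mul hu'.le]
    refine ENNReal.ofReal_le_ofReal ?_
    calc (u : ℝ) * P.real (A u) ≤ u * (c / (u : ℝ) ^ 3) := by gcongr; exact hP u hu
      _ = c / (u : ℝ) ^ 2 := by field_simp
  have hint : ∫⁻ ω, f ω ∂P ≠ ⊤ := by
    rw [lintegral_tsum fun u => (hmeas u).aemeasurable]
    simp only [lintegral_indicator_const (hA _)]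
    refine ne_top_of_le_ne_top ?_ (ENNReal.tsum_le_tsum hc)
    have hs : Summable fun u : ℕ => c / (u : ℝ) ^ 2 := by
      simpa [div_eq_mul_inv] using (Real.summable_nat_pow_inv.2 one_lt_two).mul_left c
    exact hs.tsum_ofReal_ne_top
  refine ⟨fun ω => (f ω).toReal, integrable_toReal_of_lintegral_ne_top hf.aemeasurable hint,
    fun ω => ENNReal.toReal_nonneg, ?_⟩
  filter_upwards [ae_lt_top hf hint] with ω hω u hu
  have h : (u : ENNReal) ≤ f ω := by
    refine le_trans ?_ (ENNReal.le_tsum u)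
    rw [Set.indicator_of_mem hu]
  simpa using ENNReal.toReal_mono hω.ne h

theorem IsAnytimeBound.measure_le {B : ℕ → ℝ → ℝ} (hB : IsAnytimeBound B) {X : ℕ → Ω → ℝ}
    (hX : ∀ i, Measurable (X i)) (hind : iIndepFun X P) (hlaw : ∀ i, P.map (X i) = P.map (X 0))
    (hb : ∀ᵐ ω ∂P, X 0 ω ∈ Set.Icc (0 : ℝ) 1) {ε : ℝ} (hε : 0 < ε) (hε1 : ε < 1) :
    P {ω | ∃ n : ℕ, 1 ≤ n ∧ B n ε < |(∑ i ∈ Finset.range n, X i ω) / n - ∫ ω, X 0 ω ∂P|}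
      ≤ ENNReal.ofReal ε := by
  have hprob : IsProbabilityMeasure (P.map (X 0)) :=
    Measure.isProbabilityMeasure_map (hX 0).aemeasurable
  have hmap : P.map (fun ω i => X i ω) = Measure.infinitePi fun _ : ℕ => P.map (X 0) := by
    rw [(iIndepFun_iff_map_fun_eq_infinitePi_map hX).1 hind]
    simp only [hlaw]
  have hmean : ∫ r, r ∂(P.map (X 0)) = ∫ ω, X 0 ω ∂P :=
    integral_map (hX 0).aemeasurable aestronglyMeasurable_id
  have h := hB.coverage (P.map (X 0)) hprob
    ((ae_map_iff (hX 0).aemeasurable measurableSet_Icc).2 hb) ε hε hε1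
  rw [← hmap, hmean, Measure.map_apply (measurable_pi_lambda _ hX)] at h
  · exact h
  · have : {x : ℕ → ℝ | ∃ n : ℕ, 1 ≤ n ∧
        B n ε < |(∑ i ∈ Finset.range n, x i) / n - ∫ ω, X 0 ω ∂P|}
        = ⋃ n : ℕ, {x : ℕ → ℝ | 1 ≤ n ∧
          B n ε < |(∑ i ∈ Finset.range n, x i) / n - ∫ ω, X 0 ω ∂P|} := by
      ext; simp
    rw [this]
    refine MeasurableSet.iUnion fun n => MeasurableSet.inter (.const _) ?_
    have hmeas : Measurable fun x : ℕ → ℝ =>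
        |(∑ i ∈ Finset.range n, x i) / n - ∫ ω, X 0 ω ∂P| := by fun_prop
    exact measurableSet_lt measurable_const hmeas

end Probability

end CLUCB

namespace CLUCB

/-! ### Gaps and pseudo-rewards of a bandit instance. -/

section Instance

variable {K : ℕ} {ν : Measure (Fin K → ℝ)} {s : Fin K → Fin K → ℝ → ℝ} {kstar : Fin K}

theorem mean_eq_expPseudo (hs : IsPseudoReward ν s) (k : Fin K) :
    mean ν k = expPseudo ν s k k := by
  simp [mean, expPseudo, hs.self]

theorem comap_eval_le (k : Fin K) :
    MeasurableSpace.comap (fun r : Fin K → ℝ => r k) inferInstance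
      ≤ (inferInstance : MeasurableSpace (Fin K → ℝ)) :=
  (measurable_pi_apply k).comap_le

/-- Nonnegativity is not assumed: it comes from 0 ≤ E[R_ℓ | R_k] ≤ s_{ℓ,k}(R_k). It makes
Hoeffding's inequality and `B` applicable to pseudo-rewards. -/
theorem ae_pseudo_mem_Icc (hb : ∀ᵐ r ∂ν, ∀ k, r k ∈ Set.Icc (0 : ℝ) 1)
    (hs : IsPseudoReward ν s) (ℓ k : Fin K) : ∀ᵐ r ∂ν, s ℓ k (r k) ∈ Set.Icc (0 : ℝ) 1 := by
  have h0 : 0 ≤ᵐ[ν] fun r : Fin K → ℝ => r ℓ := hb.mono fun r h => (h ℓ).1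
  filter_upwards [hb, hs.condExp_le ℓ k,
    condExp_nonneg (m := MeasurableSpace.comap (fun r : Fin K → ℝ => r k) inferInstance) h0]
    with r h1 h2 h3
  exact ⟨h3.trans h2, hs.le_one ℓ k _ (h1 k)⟩

theorem integrable_pseudo [IsProbabilityMeasure ν]
    (hb : ∀ᵐ r ∂ν, ∀ k, r k ∈ Set.Icc (0 : ℝ) 1)
    (hs : IsPseudoReward ν s) (ℓ k : Fin K) : Integrable (fun r => s ℓ k (r k)) ν :=
  Integrable.of_mem_Icc 0 1 ((hs.measurable ℓ k).comp (measurable_pi_apply k)).aemeasurable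
    (ae_pseudo_mem_Icc hb hs ℓ k)

theorem mean_le_expPseudo [IsProbabilityMeasure ν] (hb : ∀ᵐ r ∂ν, ∀ k, r k ∈ Set.Icc (0 : ℝ) 1)
    (hs : IsPseudoReward ν s) (ℓ k : Fin K) : mean ν ℓ ≤ expPseudo ν s ℓ k := by
  rw [mean, ← integral_condExp (comap_eval_le k)]
  exact integral_mono_ae integrable_condExp (integrable_pseudo hb hs ℓ k) (hs.condExp_le ℓ k)

theorem gap_of_ne {k : Fin K} (h : k ≠ kstar) : gap ν kstar k = mean ν kstar - mean ν k :=
  if_neg h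

theorem gap_kstar_le (k : Fin K) : gap ν kstar kstar ≤ gap ν kstar k := by
  by_cases h : k = kstar
  · rw [h]
  rw [gap_of_ne h, gap, if_pos rfl]
  exact ciInf_le (f := fun j : {j : Fin K // j ≠ kstar} => mean ν kstar - mean ν j)
    (Set.finite_range _).bddBelow ⟨k, h⟩

theorem nonempty_ne (hK : 2 ≤ K) (kstar : Fin K) : Nonempty {k : Fin K // k ≠ kstar} := by
  have : Nontrivial (Fin K) := Fin.nontrivial_iff_two_le.2 hK
  obtain ⟨k, hk⟩ := exists_ne kstar
  exact ⟨⟨k, hk⟩⟩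

theorem gap_kstar_pos (hK : 2 ≤ K) (hbest : ∀ k, k ≠ kstar → mean ν k < mean ν kstar) :
    0 < gap ν kstar kstar := by
  have := nonempty_ne hK kstar
  rw [gap, if_pos rfl]
  obtain ⟨j, hj⟩ := exists_eq_ciInf_of_finite
    (f := fun j : {j : Fin K // j ≠ kstar} => mean ν kstar - mean ν j)
  rw [← hj]
  exact sub_pos.2 (hbest j j.2)

theorem secondMean_add_gap_le (hK : 2 ≤ K) :
    secondMean ν kstar + gap ν kstar kstar ≤ mean ν kstar := by
  have := nonempty_ne hK kstar
  have h : secondMean ν kstar ≤ mean ν kstar - gap ν kstar kstar := by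
    refine ciSup_le fun k => ?_
    have := gap_kstar_le (ν := ν) (kstar := kstar) k
    rw [gap_of_ne k.2] at this
    linarith
  linarith

theorem isGapProfile [IsProbabilityMeasure ν] (hK : 2 ≤ K)
    (hb : ∀ᵐ r ∂ν, ∀ k, r k ∈ Set.Icc (0 : ℝ) 1) (hs : IsPseudoReward ν s)
    (hbest : ∀ k, k ≠ kstar → mean ν k < mean ν kstar) :
    IsGapProfile (expPseudo ν s) kstar (competitive ν s kstar) (gap ν kstar) where
  pos := gap_kstar_pos hK hbest
  min_le := gap_kstar_le
  add_le k hk := by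
    rw [gap_of_ne hk, ← mean_eq_expPseudo hs, ← mean_eq_expPseudo hs]
    linarith
  le_cross k := by
    rw [← mean_eq_expPseudo hs]
    exact mean_le_expPseudo hb hs kstar k
  mem := by
    have h1 := secondMean_add_gap_le (ν := ν) (kstar := kstar) hK
    have h2 := gap_kstar_pos hK hbest
    simp only [competitive, Finset.mem_filter, Finset.mem_univ, true_and]
    rw [← mean_eq_expPseudo hs]
    linarith
  cross_add_le ℓ hℓ := by
    have h1 := secondMean_add_gap_le (ν := ν) (kstar := kstar) hK
    simp only [competitive, Finset.mem_filter, Finset.mem_univ, true_and, not_le] at hℓ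
    rw [← mean_eq_expPseudo hs kstar]
    linarith

end Instance

/-! ### Probability of the good events for the reward table. -/

section Table

variable {K : ℕ} {ν : Measure (Fin K → ℝ)} {s : Fin K → Fin K → ℝ → ℝ}
  {Ω : Type*} {mΩ : MeasurableSpace Ω} {P : Measure Ω} {Z : Fin K → ℕ → Ω → ℝ}

theorem ae_pseudo_sample_mem_Icc (hb : ∀ᵐ r ∂ν, ∀ k, r k ∈ Set.Icc (0 : ℝ) 1)
    (hs : IsPseudoReward ν s) (hZm : ∀ k i, Measurable (Z k i))
    (hZlaw : ∀ k i, P.map (Z k i) = ν.map (fun r => r k)) (ℓ k : Fin K) (i : ℕ) :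
    ∀ᵐ ω ∂P, s ℓ k (Z k i ω) ∈ Set.Icc (0 : ℝ) 1 := by
  have hmeas : MeasurableSet {r : ℝ | s ℓ k r ∈ Set.Icc (0 : ℝ) 1} :=
    hs.measurable ℓ k measurableSet_Icc
  refine (ae_map_iff (p := fun r => s ℓ k r ∈ Set.Icc (0 : ℝ) 1)
    (hZm k i).aemeasurable hmeas).1 ?_
  rw [hZlaw]
  exact (ae_map_iff (measurable_pi_apply k).aemeasurable hmeas).2 (ae_pseudo_mem_Icc hb hs ℓ k)

theorem integral_pseudo_sample (hs : IsPseudoReward ν s) (hZm : ∀ k i, Measurable (Z k i))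
    (hZlaw : ∀ k i, P.map (Z k i) = ν.map (fun r => r k)) (ℓ k : Fin K) (i : ℕ) :
    ∫ ω, s ℓ k (Z k i ω) ∂P = expPseudo ν s ℓ k := by
  have hmeas := hs.measurable ℓ k
  rw [expPseudo, ← integral_map (φ := Z k i) (f := s ℓ k) (hZm k i).aemeasurable
      hmeas.aestronglyMeasurable, hZlaw,
    integral_map (measurable_pi_apply k).aemeasurable hmeas.aestronglyMeasurable]

theorem measurable_pseudoAvg (hs : IsPseudoReward ν s) (hZm : ∀ k i, Measurable (Z k i))
    (ℓ k : Fin K) (n : ℕ) : Measurable fun ω => pseudoAvg s (fun k i => Z k i ω) ℓ k n :=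
  (Finset.measurable_sum _ fun i _ => (hs.measurable ℓ k).comp (hZm k i)).div_const _

/-- The event that in round `u` some average pseudo-reward deviates from its expectation by more
than the width of the PseudoUCB index. -/
def deviationEvent (s : Fin K → Fin K → ℝ → ℝ) (Z : Fin K → ℕ → Ω → ℝ)
    (φ : Fin K → Fin K → ℝ) (u : ℕ) : Set Ω :=
  ⋃ p ∈ (Finset.univ : Finset (Fin K × Fin K)) ×ˢ Finset.Icc 1 u,
    {ω | √(2 * Real.log u / (p.2 : ℕ)) <
      |pseudoAvg s (fun k i => Z k i ω) p.1.1 p.1.2 p.2 - φ p.1.1 p.1.2|}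

theorem measurableSet_deviationEvent (hs : IsPseudoReward ν s)
    (hZm : ∀ k i, Measurable (Z k i)) (φ : Fin K → Fin K → ℝ) (u : ℕ) :
    MeasurableSet (deviationEvent s Z φ u) :=
  Finset.measurableSet_biUnion _ fun p _ =>
    measurableSet_lt measurable_const ((measurable_pseudoAvg hs hZm p.1.1 p.1.2 p.2).sub_const _).abs

theorem measureReal_deviationEvent_le [IsProbabilityMeasure P]
    (hb : ∀ᵐ r ∂ν, ∀ k, r k ∈ Set.Icc (0 : ℝ) 1)
    (hs : IsPseudoReward ν s) (hZm : ∀ k i, Measurable (Z k i))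
    (hZlaw : ∀ k i, P.map (Z k i) = ν.map (fun r => r k)) (hZ : ∀ k, iIndepFun (Z k) P)
    {u : ℕ} (hu : 1 ≤ u) :
    P.real (deviationEvent s Z (expPseudo ν s) u) ≤ 2 * (K : ℝ) ^ 2 / (u : ℝ) ^ 3 := by
  have hu' : (0 : ℝ) < u := by exact_mod_cast hu
  have hlog : 0 ≤ Real.log u := Real.log_natCast_nonneg u
  refine (measureReal_biUnion_finset_le _ _).trans ?_
  -- The width turns Hoeffding's bound into 2 exp(-4 log u) = 2/u⁴, summed over K² pairs and u
  -- sample counts.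
  refine (Finset.sum_le_card_nsmul _ _ (2 / (u : ℝ) ^ 4) fun p hp => ?_).trans (le_of_eq ?_)
  · have hn := (Finset.mem_Icc.1 (Finset.mem_product.1 hp).2).1
    have hn' : (0 : ℝ) < (p.2 : ℕ) := by exact_mod_cast hn
    have h := measure_lt_abs_avg_sub_le (P := P)
      (X := fun i ω => s p.1.1 p.1.2 (Z p.1.2 i ω))
      (fun i => (hs.measurable _ _).comp (hZm _ i))
      ((hZ p.1.2).comp (fun _ => s p.1.1 p.1.2) fun _ => hs.measurable _ _)
      (fun i => ae_pseudo_sample_mem_Icc hb hs hZm hZlaw p.1.1 p.1.2 i)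
      (fun i => integral_pseudo_sample hs hZm hZlaw p.1.1 p.1.2 i) hn
      (Real.sqrt_nonneg (2 * Real.log u / (p.2 : ℕ)))
    refine h.trans (le_of_eq ?_)
    rw [Real.sq_sqrt (by positivity), show -2 * ((p.2 : ℕ) : ℝ) * (2 * Real.log u / (p.2 : ℕ))
      = -((4 : ℕ) * Real.log u) by push_cast; field_simp; ring, Real.exp_neg, Real.exp_nat_mul,
      Real.exp_log hu']
    rfl
  · simp
    field_simp

theorem measurableSet_covered {B : ℕ → ℝ → ℝ} (hs : IsPseudoReward ν s)
    (hZm : ∀ k i, Measurable (Z k i)) (φ : Fin K → Fin K → ℝ) (kstar : Fin K) (ε : ℝ) :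
    MeasurableSet {ω | Covered B s (fun k i => Z k i ω) φ kstar ε} := by
  have h : ∀ ℓ k n, MeasurableSet
      {ω | |pseudoAvg s (fun k i => Z k i ω) ℓ k n - φ ℓ k| ≤ B n ε} := fun ℓ k n =>
    measurableSet_le ((measurable_pseudoAvg hs hZm ℓ k n).sub_const _).abs measurable_const
  have h' : {ω | Covered B s (fun k i => Z k i ω) φ kstar ε} =
      ⋂ k, ⋂ n, ⋂ _ : 1 ≤ n,
        ({ω | |pseudoAvg s (fun k i => Z k i ω) k k n - φ k k| ≤ B n ε} ∩
          {ω | |pseudoAvg s (fun k i => Z k i ω) kstar k n - φ kstar k| ≤ B n ε}) := by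
    ext ω
    simp [Covered]
  rw [h']
  exact .iInter fun k => .iInter fun n => .iInter fun _ => (h k k n).inter (h kstar k n)

theorem measure_not_covered_le [IsProbabilityMeasure P] {B : ℕ → ℝ → ℝ}
    (hB : IsAnytimeBound B)
    (hb : ∀ᵐ r ∂ν, ∀ k, r k ∈ Set.Icc (0 : ℝ) 1)
    (hs : IsPseudoReward ν s) (hZm : ∀ k i, Measurable (Z k i))
    (hZlaw : ∀ k i, P.map (Z k i) = ν.map (fun r => r k)) (hZ : ∀ k, iIndepFun (Z k) P)
    (hK : 1 ≤ K) (kstar : Fin K) {δ : ℝ} (hδ : 0 < δ) (hδ1 : δ < 1) :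
    P {ω | Covered B s (fun k i => Z k i ω) (expPseudo ν s) kstar (δ / (2 * K))}ᶜ
      ≤ ENNReal.ofReal δ := by
  have hK' : (1 : ℝ) ≤ K := by exact_mod_cast hK
  set ε := δ / (2 * K) with hε
  have hε0 : 0 < ε := by positivity
  have hε1 : ε < 1 := by
    rw [hε, div_lt_one (by positivity)]
    linarith
  let D : Fin K → Fin K → Set Ω := fun ℓ k => {ω | ∃ n : ℕ, 1 ≤ n ∧
    B n ε < |pseudoAvg s (fun k i => Z k i ω) ℓ k n - expPseudo ν s ℓ k|}
  have hD : ∀ ℓ k, P (D ℓ k) ≤ ENNReal.ofReal ε := by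
    intro ℓ k
    have hlaw : ∀ i, P.map (fun ω => s ℓ k (Z k i ω)) = (ν.map fun r => r k).map (s ℓ k) :=
      fun i => by rw [← hZlaw k i, Measure.map_map (hs.measurable ℓ k) (hZm k i)]; rfl
    have h := hB.measure_le (P := P) (X := fun i ω => s ℓ k (Z k i ω))
      (fun i => (hs.measurable _ _).comp (hZm _ i))
      ((hZ k).comp (fun _ => s ℓ k) fun _ => hs.measurable _ _)
      (fun i => (hlaw i).trans (hlaw 0).symm)
      (ae_pseudo_sample_mem_Icc hb hs hZm hZlaw ℓ k 0) hε0 hε1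
    rw [integral_pseudo_sample hs hZm hZlaw] at h
    exact h
  have hsub : {ω | Covered B s (fun k i => Z k i ω) (expPseudo ν s) kstar ε}ᶜ ⊆
      ⋃ k, (D k k ∪ D kstar k) := by
    intro ω hω
    simp only [Covered, Set.mem_compl_iff, Set.mem_ofPred_eq, not_forall] at hω
    obtain ⟨k, n, hn, h⟩ := hω
    refine Set.mem_iUnion.2 ⟨k, ?_⟩
    rcases not_and_or.1 h with h | h
    · exact Or.inl ⟨n, hn, not_le.1 h⟩
    · exact Or.inr ⟨n, hn, not_le.1 h⟩
  calc _ ≤ _ := measure_mono hsub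
    _ ≤ ∑ k, P (D k k ∪ D kstar k) := measure_iUnion_fintype_le _ _
    _ ≤ ∑ _k : Fin K, ENNReal.ofReal (2 * ε) := by
      refine Finset.sum_le_sum fun k _ => (measure_union_le _ _).trans ?_
      rw [two_mul, ENNReal.ofReal_add hε0.le hε0.le]
      exact add_le_add (hD k k) (hD kstar k)
    _ = ENNReal.ofReal δ := by
      rw [Finset.sum_const, Finset.card_univ, Fintype.card_fin, ← ENNReal.ofReal_nsmul]
      congr 1
      rw [hε, nsmul_eq_mul]
      field_simp

end Table

end CLUCB

/-! ### Combination of the pathwise and probabilistic bounds. -/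

theorem corollary1 (B : ℕ → ℝ → ℝ) (hB : CLUCB.IsAnytimeBound B) :
    ∃ ζ : ℝ, 0 < ζ ∧
      ∀ (K : ℕ) (_hK : 2 ≤ K)
        -- joint law of the reward vector, with rewards in `[0,1]`
        (ν : Measure (Fin K → ℝ)) (_hν : IsProbabilityMeasure ν)
        (_hbdd : ∀ᵐ r ∂ν, ∀ k, r k ∈ Set.Icc (0 : ℝ) 1)
        -- pseudo-rewards
        (s : Fin K → Fin K → ℝ → ℝ) (_hs : CLUCB.IsPseudoReward ν s)
        -- the best arm
        (kstar : Fin K) (_hbest : ∀ k, k ≠ kstar → CLUCB.mean ν k < CLUCB.mean ν kstar)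
        -- so that `log (log (1 / Δ_k²))` is defined
        (_hgap : ∀ k ∈ CLUCB.competitive ν s kstar, CLUCB.gap ν kstar k < 1)
        -- `Z k i` is the reward seen when arm `k` is sampled for the `(i+1)`-st time
        (Ω : Type*) (_mΩ : MeasurableSpace Ω) (P : Measure Ω) (_hP : IsProbabilityMeasure P)
        (Z : Fin K → ℕ → Ω → ℝ) (_hZm : ∀ k i, Measurable (Z k i))
        (_hZlaw : ∀ k i, P.map (Z k i) = ν.map (fun r => r k))
        (_hZindep : ∀ k, iIndepFun (Z k) P),
        ∃ d₁ d₂ : Ω → ℝ, Integrable d₁ P ∧ Integrable d₂ P ∧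
          ∀ δ : ℝ, 0 < δ → δ < 1 →
            ∃ G : Set Ω, MeasurableSet G ∧ ENNReal.ofReal (1 - δ) ≤ P G ∧
              ∀ ω ∈ G, ∀ R : CLUCB.Run B s δ (fun k i => Z k i ω),
                ∃ T : ℕ, R.StopsAt T ∧
                  (R.roundsNC (CLUCB.competitive ν s kstar) kstar T : ℝ) ≤ d₁ ω ∧
                  (R.roundsR kstar (CLUCB.mean ν kstar) T : ℝ) ≤ d₂ ω ∧
                  (R.samples T : ℝ) ≤
                    ∑ k ∈ CLUCB.competitive ν s kstar,
                      2 * ζ / CLUCB.gap ν kstar k ^ 2 *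
                        Real.log (2 * K * Real.log (1 / CLUCB.gap ν kstar k ^ 2) / δ)
                    + max (d₁ ω) (d₂ ω) := by

  obtain ⟨c₀, hc₀⟩ := hB.rate
  have hc : ∀ n : ℕ, 3 ≤ n → ∀ δ : ℝ, 0 < δ → δ < 1 →
      B n δ ≤ max c₀ 1 * √(Real.log (Real.log n / δ) / n) := fun n hn δ h0 h1 =>
    (hc₀ n hn δ h0 h1).trans
      (mul_le_mul_of_nonneg_right (le_max_left _ _) (Real.sqrt_nonneg _))
  set c := max c₀ 1
  have hc1 : 1 ≤ c := le_max_right _ _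
  refine ⟨128 * c ^ 2, by positivity, ?_⟩
  intro K hK ν hν hbdd s hs kstar hbest hgap Ω mΩ P hP Z hZm hZlaw hZindep
  have hφ := CLUCB.isGapProfile hK hbdd hs hbest
  have hpos : ∀ k, 0 < CLUCB.gap ν kstar k := fun k => hφ.pos.trans_le (hφ.min_le k)
  obtain ⟨M, hM1, hM⟩ := CLUCB.exists_logNegligible K (CLUCB.gap ν kstar kstar)
  have hn₀ := fun k => CLUCB.exists_bound_le hc1 hc (by omega : 1 ≤ K) (hpos k)
  choose n₀ hn₀ using hn₀
  obtain ⟨τ, hτint, hτ0, hτ⟩ := CLUCB.exists_integrable_last_le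
    (CLUCB.measurableSet_deviationEvent hs hZm (CLUCB.expPseudo ν s))
    (fun u hu => CLUCB.measureReal_deviationEvent_le hbdd hs hZm hZlaw hZindep hu)
  -- `D` collects every cost free of δ. The absolute value compensates for log(2K log(1/Δ_k²)),
  -- which is negative when Δ_k is close to 1.
  let D : ℝ := K + 2 * M + ∑ k ∈ CLUCB.competitive ν s kstar, (2 * ((n₀ k : ℝ) + 1) +
    |2 * (128 * c ^ 2) / CLUCB.gap ν kstar k ^ 2 *
      Real.log (2 * K * Real.log (1 / CLUCB.gap ν kstar k ^ 2))|)
  have hMD : (M : ℝ) ≤ D := by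
    have h1 : (0 : ℝ) ≤ K + M := by positivity
    have h2 : 0 ≤ ∑ k ∈ CLUCB.competitive ν s kstar, (2 * ((n₀ k : ℝ) + 1) +
      |2 * (128 * c ^ 2) / CLUCB.gap ν kstar k ^ 2 *
        Real.log (2 * K * Real.log (1 / CLUCB.gap ν kstar k ^ 2))|) :=
      Finset.sum_nonneg fun k _ => by positivity
    change (M : ℝ) ≤ K + 2 * M + _
    linarith
  have hint : Integrable (fun ω => 4 * τ ω + D) P := (hτint.const_mul 4).add (integrable_const D)
  -- The factor 4 is two samples in each of the 2N initial rounds, with N = ⌊τ⌋.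
  refine ⟨fun ω => 4 * τ ω + D, fun ω => 4 * τ ω + D, hint, hint, fun δ hδ hδ1 => ?_⟩
  let E : Set Ω := {ω | CLUCB.Covered B s (fun k i => Z k i ω) (CLUCB.expPseudo ν s) kstar
    (δ / (2 * K))}
  have hE : MeasurableSet E := CLUCB.measurableSet_covered hs hZm _ kstar _
  -- The exceptional null set need not be measurable; its measurable hull is discarded instead.
  let S : Set Ω := toMeasurable P
    {ω | ∀ u : ℕ, ω ∈ CLUCB.deviationEvent s Z (CLUCB.expPseudo ν s) u → (u : ℝ) ≤ τ ω}ᶜ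
  have hS : P S = 0 := (measure_toMeasurable _).trans hτ
  refine ⟨E ∩ Sᶜ, hE.inter (measurableSet_toMeasurable _ _).compl, ?_, ?_⟩
  · have h1 : P (E ∩ Sᶜ) = P E := measure_inter_conull (by rwa [compl_compl])
    have h2 : P Eᶜ ≤ ENNReal.ofReal δ :=
      CLUCB.measure_not_covered_le hB hbdd hs hZm hZlaw hZindep (by omega) kstar hδ hδ1
    rw [h1, ENNReal.ofReal_sub _ hδ.le, ENNReal.ofReal_one, tsub_le_iff_right,
      ← prob_add_prob_compl (μ := P) hE]
    gcongr
  rintro ω ⟨hωE, hωS⟩ R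
  have hωτ : ∀ u : ℕ, ω ∈ CLUCB.deviationEvent s Z (CLUCB.expPseudo ν s) u → (u : ℝ) ≤ τ ω := by
    by_contra hcon
    exact hωS (subset_toMeasurable _ _ hcon)
  have hN : CLUCB.ConcentratedAfter s (fun k i => Z k i ω) (CLUCB.expPseudo ν s) ⌊τ ω⌋₊ := by
    intro t ht ℓ k n hn hnt
    by_contra! hcon
    refine absurd (Nat.le_floor (hωτ t ?_)) (not_le.2 ht)
    exact Set.mem_biUnion (x := ((ℓ, k), n))
      (Finset.mem_coe.2 (Finset.mem_product.2 ⟨Finset.mem_univ _, Finset.mem_Icc.2 ⟨hn, hnt⟩⟩)) hcon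
  let h : Fin K → ℕ := fun k =>
    ⌈128 * c ^ 2 / CLUCB.gap ν kstar k ^ 2 * Real.log (1 / δ) + n₀ k⌉₊
  obtain ⟨T, hT, hNC, hR, hsamp⟩ := R.exists_stopsAt hs.self hφ hωE hN hM hM1 (h := h)
    fun k n hkn => hn₀ k δ hδ hδ1 n (Nat.ceil_le.1 hkn)
  have hfloor : (⌊τ ω⌋₊ : ℝ) ≤ τ ω := Nat.floor_le (hτ0 ω)
  have hM0 : (0 : ℝ) ≤ M := M.cast_nonneg
  have hτω := hτ0 ω
  refine ⟨T, hT, ?_, ?_, ?_⟩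
  · have : (R.roundsNC (CLUCB.competitive ν s kstar) kstar T : ℝ) ≤ 2 * ⌊τ ω⌋₊ + M := by
      exact_mod_cast hNC
    linarith
  · rw [CLUCB.mean_eq_expPseudo hs]
    have : (R.roundsR kstar (CLUCB.expPseudo ν s kstar kstar) T : ℝ) ≤ ⌊τ ω⌋₊ := by
      exact_mod_cast hR
    linarith
  · have h1 : (R.samples T : ℝ) ≤
        K + 2 * (2 * ⌊τ ω⌋₊ + M + ∑ k ∈ CLUCB.competitive ν s kstar, (h k : ℝ)) := by
      exact_mod_cast hsamp
    have h2 : 2 * ∑ k ∈ CLUCB.competitive ν s kstar, (h k : ℝ) ≤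
        ∑ k ∈ CLUCB.competitive ν s kstar, 2 * (128 * c ^ 2) / CLUCB.gap ν kstar k ^ 2 *
          Real.log (2 * K * Real.log (1 / CLUCB.gap ν kstar k ^ 2) / δ) +
        ∑ k ∈ CLUCB.competitive ν s kstar, (2 * ((n₀ k : ℝ) + 1) +
          |2 * (128 * c ^ 2) / CLUCB.gap ν kstar k ^ 2 *
            Real.log (2 * K * Real.log (1 / CLUCB.gap ν kstar k ^ 2))|) := by
      rw [Finset.mul_sum, ← Finset.sum_add_distrib]
      refine Finset.sum_le_sum fun k hk => ?_
      have hΔ := hpos k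
      have hK' : (0 : ℝ) < K := by exact_mod_cast (by omega : 0 < K)
      have hlog : 0 < Real.log (1 / CLUCB.gap ν kstar k ^ 2) := by
        refine Real.log_pos ?_
        rw [lt_div_iff₀ (by positivity), one_mul]
        exact pow_lt_one₀ hΔ.le (hgap k hk) two_ne_zero
      have hx : 0 < Real.log (1 / δ) := Real.log_pos (by rw [lt_div_iff₀ hδ]; linarith)
      have hsplit : Real.log (2 * K * Real.log (1 / CLUCB.gap ν kstar k ^ 2) / δ) =
          Real.log (2 * K * Real.log (1 / CLUCB.gap ν kstar k ^ 2)) + Real.log (1 / δ) := by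
        rw [← Real.log_mul (by positivity) (by positivity)]
        congr 1
        ring
      have hceil : (h k : ℝ) <
          128 * c ^ 2 / CLUCB.gap ν kstar k ^ 2 * Real.log (1 / δ) + n₀ k + 1 :=
        Nat.ceil_lt_add_one (by positivity)
      have habs := neg_abs_le (2 * (128 * c ^ 2) / CLUCB.gap ν kstar k ^ 2 *
        Real.log (2 * K * Real.log (1 / CLUCB.gap ν kstar k ^ 2)))
      have hring : 2 * (128 * c ^ 2) / CLUCB.gap ν kstar k ^ 2 * Real.log (1 / δ) =
          2 * (128 * c ^ 2 / CLUCB.gap ν kstar k ^ 2 * Real.log (1 / δ)) := by ring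
      rw [hsplit, mul_add, hring]
      linarith
    rw [max_self]
    change _ ≤ _ + (4 * τ ω + (K + 2 * M + _))
    linarith
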